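/- A parity game $G=(V,E,\Omega,(V_{0},V_{1}))$ has a finite vertex set $V$ partitioned into the vertices $V_0$ of player even and $V_1$ of player odd, an edge relation $E\subseteq V\times V$ (sinks allowed) and priorities $\Omega\colon V\to\mathbb N$. Plays are maximal paths; a finite play is lost by the owner of the sink in which it ends, and an infinite play is won by even if and only if the least priority occurring infinitely often is even. A strategy of player $\alpha$ is a partial function that assigns to a finite sequence of vertices ending in a vertex of $V_\alpha$ a successor of that last vertex; it is winning in $v$ if all plays from $v$ consistent with it are won by $\alpha$, and $\alpha$ wins $v$ if she has a strategy that is winning in $v$. Write $\bar\alpha$ for the opponent of $\alpha$. An $\alpha$-dominion is a set $D\subseteq V$ for which $\alpha$ has a strategy that is winning in every vertex of $D$ and such that all consistent plays starting in $D$ stay in $D$. For $X\subseteq V$, $\mathrm{Attr}_\alpha^G(X)$ is the least set $Z \supseteq X$ that contains every $v\in V_\alpha$ with a successor in $Z$ and every non-sink $v\in V_{\bar\alpha}$ all of whose successors lie in $Z$; $G\cap X$ is the subgame induced on $X$. An incomplete parity game is a pair $\mathcal G=(G,I)$ with $I\subseteq V$ the set of incomplete vertices. It is extended by $\mathcal G'=(G',I')$,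 written $\mathcal G\sqsubseteq\mathcal G'$, if $V\subseteq V'$, $V_0\subseteq V_0'$, $V_1\subseteq V_1'$, $E\subseteq E'$, $((V\setminus I)\times V')\cap E'\subseteq E$, $\Omega=\Omega'|_V$ and $I'\cap V\subseteq I$. A vertex is won in $\mathcal G$ if it is won in $G$. The $\alpha$-safe set is $\mathrm{safe}_\alpha(\mathcal G)=V\setminus\mathrm{Attr}^G_{\bar\alpha}(V_{\bar\alpha}\cap I)$. **Theorem.** Let $\mathcal G=(G,I)$ be an incomplete parity game. For each player $\alpha$ let $W_\alpha$ be the union of all $\alpha$-dominions in $G\cap\mathrm{safe}_\alpha(\mathcal G)$, and let $W_?=V\setminus(W_0\cup W_1)$. Then, for each player $\alpha$, $W_?$ is the largest set of vertices $v \in V$ for which there are incomplete parity games $\mathcal G^\alpha$ and $\mathcal G^{\bar\alpha}$ with $\mathcal G\sqsubseteq\mathcal G^\alpha$ and $\mathcal G\sqsubseteq\mathcal G^{\bar\alpha}$ such that $v$ is won by $\alpha$ in $\mathcal G^\alpha$ and by $\bar\alpha$ in $\mathcal G^{\bar\alpha}$. -/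

import Mathlib

/-- The two players of a parity game. -/
inductive Player : Type
  | even
  | odd

/-- The opponent of a player. -/
def Player.opp : Player → Player
  | Player.even => Player.odd
  | Player.odd => Player.even

/-- The priorities that are good for a player: the even ones for `even`, the others for `odd`. -/
def Player.Good : Player → ℕ → Prop
  | Player.even, p => Even p
  | Player.odd, p => ¬ Even p

/-- A parity game `(V, E, prio, (V_even, V_odd))` whose vertices are taken from a universe `U` of
possible vertices. Only the values of `prio` on the vertices of the game matter. -/
structure ParityGame (U : Type*) where
  /-- The vertex set `V`. -/
  verts : Set U
  finite_verts : verts.Finite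
  /-- `own α` is the set `V_α` of vertices owned by player `α`. -/
  own : Player → Set U
  own_union : own Player.even ∪ own Player.odd = verts
  own_disjoint : Disjoint (own Player.even) (own Player.odd)
  /-- The edge relation `E ⊆ V × V`. -/
  edge : U → U → Prop
  edge_mem : ∀ v w, edge v w → v ∈ verts ∧ w ∈ verts
  /-- The priority function. -/
  prio : U → ℕ

namespace ParityGame

variable {U : Type*}

/-- The vertices without successors. -/
def sinks (G : ParityGame U) : Set U :=
  {v | v ∈ G.verts ∧ ∀ w, ¬ G.edge v w}

/-- The subgame `G ∩ X`. -/
def restrict (G : ParityGame U) (X : Set U) : ParityGame U where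
  verts := G.verts ∩ X
  finite_verts := G.finite_verts.inter_of_left X
  own := fun α => G.own α ∩ X
  own_union := by rw [← Set.union_inter_distrib_right, G.own_union]
  own_disjoint := G.own_disjoint.mono Set.inter_subset_left Set.inter_subset_left
  edge := fun v w => G.edge v w ∧ v ∈ X ∧ w ∈ X
  edge_mem := fun v w h =>
    ⟨⟨(G.edge_mem v w h.1).1, h.2.1⟩, ⟨(G.edge_mem v w h.1).2, h.2.2⟩⟩
  prio := G.prio

/-- `G.IsPlay N π`: the sequence `π 0, π 1, …` with last index `N` (infinite when `N = ⊤`) is a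
play: it follows edges and is maximal, that is, infinite or ending in a sink. Values of `π` beyond
the index `N` are irrelevant. -/
structure IsPlay (G : ParityGame U) (N : ℕ∞) (π : ℕ → U) : Prop where
  start : π 0 ∈ G.verts
  step : ∀ i : ℕ, (i : ℕ∞) < N → G.edge (π i) (π (i + 1))
  maximal : ∀ n : ℕ, N = (n : ℕ∞) → π n ∈ G.sinks

/-- The play `π` with last index `N` is won by player `α`: it ends in a sink of the opponent, or it
is infinite and the least priority that occurs infinitely often is good for `α`. -/
def PlayWonBy (G : ParityGame U) (α : Player) (N : ℕ∞) (π : ℕ → U) : Prop :=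
  (∃ n : ℕ, N = (n : ℕ∞) ∧ π n ∈ G.own α.opp) ∨
  (N = ⊤ ∧ ∃ p : ℕ, IsLeast {q : ℕ | ∃ᶠ i in Filter.atTop, G.prio (π i) = q} p ∧ α.Good p)

/-- A strategy for player `α`: a partial function that, given the vertices `h` visited so far and
the current vertex `v` owned by `α`, may prescribe a move along an edge. -/
structure Strategy (G : ParityGame U) (α : Player) where
  /-- The prescribed successor, if any. -/
  move : List U → U → Option U
  legal : ∀ h v w, move h v = some w → v ∈ G.own α ∧ G.edge v w

/-- The play `π` with last index `N` follows `σ` wherever `σ` is defined. -/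
def Strategy.Consistent {G : ParityGame U} {α : Player} (σ : G.Strategy α) (N : ℕ∞)
    (π : ℕ → U) : Prop :=
  ∀ i : ℕ, (i : ℕ∞) < N → ∀ w, σ.move ((List.range i).map π) (π i) = some w → π (i + 1) = w

/-- `σ` is winning for `α` in `v`: `α` wins all plays from `v` that are consistent with `σ`. -/
def Strategy.WinningFrom {G : ParityGame U} {α : Player} (σ : G.Strategy α) (v : U) : Prop :=
  ∀ N π, G.IsPlay N π → π 0 = v → σ.Consistent N π → G.PlayWonBy α N π

/-- `σ` is closed on `X`: consistent plays that start in `X` remain in `X`. -/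
def Strategy.ClosedOn {G : ParityGame U} {α : Player} (σ : G.Strategy α) (X : Set U) : Prop :=
  ∀ N π, G.IsPlay N π → π 0 ∈ X → σ.Consistent N π → ∀ i : ℕ, (i : ℕ∞) ≤ N → π i ∈ X

/-- Player `α` wins the vertex `v` of `G`. -/
def Wins (G : ParityGame U) (α : Player) (v : U) : Prop :=
  v ∈ G.verts ∧ ∃ σ : G.Strategy α, σ.WinningFrom v

/-- `D` is a dominion of player `α` in `G`. -/
def IsDominion (G : ParityGame U) (α : Player) (D : Set U) : Prop :=
  D ⊆ G.verts ∧ ∃ σ : G.Strategy α, σ.ClosedOn D ∧ ∀ v ∈ D, σ.WinningFrom v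

/-- The predecessors of `X`. -/
def pre (G : ParityGame U) (X : Set U) : Set U :=
  {v | v ∈ G.verts ∧ ∃ u ∈ X, G.edge v u}

/-- The control predecessors of `X` for player `α`. -/
def cpre (G : ParityGame U) (α : Player) (X : Set U) : Set U :=
  (G.own α ∩ G.pre X) ∪ (G.own α.opp \ (G.pre (G.verts \ X) ∪ G.sinks))

theorem cpre_mono (G : ParityGame U) (α : Player) : Monotone (G.cpre α) := by
  rintro X Y hXY v (⟨hv, hv', u, hu, he⟩ | ⟨hv, hn⟩)
  · exact Or.inl ⟨hv, hv', u, hXY hu, he⟩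
  · refine Or.inr ⟨hv, fun h => hn ?_⟩
    rcases h with ⟨hv', u, hu, he⟩ | h
    · exact Or.inl ⟨hv', u, ⟨hu.1, fun hx => hu.2 (hXY hx)⟩, he⟩
    · exact Or.inr h

/-- The `α`-attractor to `X`: the least fixed point of `Z ↦ X ∪ cpre α Z`. -/
def attr (G : ParityGame U) (α : Player) (X : Set U) : Set U :=
  OrderHom.lfp
    { toFun := fun Z => X ∪ G.cpre α Z
      monotone' := fun _ _ h => Set.union_subset_union_right X (G.cpre_mono α h) }

end ParityGame

/-- An incomplete parity game `(G, I)`; `I` is the set of incomplete vertices. -/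
structure IncompleteParityGame (U : Type*) where
  /-- The underlying parity game. -/
  game : ParityGame U
  /-- The incomplete vertices. -/
  incomplete : Set U
  incomplete_subset : incomplete ⊆ game.verts

namespace IncompleteParityGame

variable {U : Type*}

/-- The ordering `𝒢 ⊑ 𝒢'`: vertices, owners, priorities and edges are kept, the complete vertices of
`𝒢` get no new successors and stay complete. -/
structure IsExtendedBy (𝒢 𝒢' : IncompleteParityGame U) : Prop where
  verts_subset : 𝒢.game.verts ⊆ 𝒢'.game.verts
  own_subset : ∀ α, 𝒢.game.own α ⊆ 𝒢'.game.own α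
  edge_mono : ∀ v w, 𝒢.game.edge v w → 𝒢'.game.edge v w
  edge_complete : ∀ v ∈ 𝒢.game.verts \ 𝒢.incomplete, ∀ w, 𝒢'.game.edge v w → 𝒢.game.edge v w
  prio_eq : ∀ v ∈ 𝒢.game.verts, 𝒢.game.prio v = 𝒢'.game.prio v
  incomplete_subset : 𝒢'.incomplete ∩ 𝒢.game.verts ⊆ 𝒢.incomplete

/-- The `α`-safe vertices: those outside the opponent's attractor to her incomplete vertices. -/
def safe (𝒢 : IncompleteParityGame U) (α : Player) : Set U :=
  𝒢.game.verts \ 𝒢.game.attr α.opp (𝒢.game.own α.opp ∩ 𝒢.incomplete)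

/-- `W_α`: the union of all `α`-dominions in the subgame on the `α`-safe vertices. -/
def W (𝒢 : IncompleteParityGame U) (α : Player) : Set U :=
  ⋃₀ {D | (𝒢.game.restrict (𝒢.safe α)).IsDominion α D}

/-- `W_?`: the vertices in neither `W_even` nor `W_odd`. -/
def Wunknown (𝒢 : IncompleteParityGame U) : Set U :=
  𝒢.game.verts \ (𝒢.W Player.even ∪ 𝒢.W Player.odd)

end IncompleteParityGame

/-!
The proof rests on positional determinacy of finite parity games, `exists_forces_cover`.

*Vertices of `W_?` can be won by either player.* To let `α` win as much as possible, add one new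
sink owned by the opponent, give each incomplete vertex of `α` an edge to it, and declare everything
complete (`IncompleteParityGame.favour`). By determinacy, a vertex that `α` does not win in this
game lies in a positional dominion `D` of the opponent. Such a `D` cannot contain an incomplete
vertex of `α`, since `α` would move to the new sink, and therefore `D` avoids the whole attractor to
these vertices. Hence `D` is a dominion of the opponent in her safe subgame of the original game,
and the vertex lies in her `W` (`wins_favour_or_mem_W`).

*Vertices of `W_β` are won by `β` in every extension.* In the `β`-safe subgame, the opponent's
vertices are complete and have no edges leaving the subgame, and the strategy of `β` never leaves
it. So each consistent play of an extension is a play of the subgame (`wins_of_mem_W`). As no vertex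
is won by both players (`not_wins_both`), no vertex of `W_β` can be won by the opponent in an
extension.

*Determinacy.* Take maximal positional dominions of both players in `X`, and suppose that the set `Y`
of the other vertices is nonempty. By maximality no vertex can be added to either dominion, so the
subgame on `Y` has no sinks, and no player can leave `Y` for her own dominion. Let `p` be the least
priority in `Y`, let `α` be the player who likes it, let `T` be the set of vertices of `Y` of
priority `p`, and let `A` be a maximal subset of `Y` from which `α` can force a visit to `T`. By
induction the subgame on `Y \ A` splits into dominions. If that of the opponent is nonempty, it
enlarges her dominion in `X`; otherwise `α` wins all of `Y`, by visiting `T` infinitely often or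
staying in `Y \ A` from some point on. Either way, maximality is contradicted. Both uses of
maximality, and the gluing of strategies, are instances of the single lemma `Forces.union`.
-/

/-! ### Players and winning conditions -/

theorem Player.opp_opp (α : Player) : α.opp.opp = α := by cases α <;> rfl

theorem Player.eq_or_eq_opp (α β : Player) : β = α ∨ β = α.opp := by
  cases α <;> cases β <;> simp [Player.opp]

theorem Player.good_opp (α : Player) (p : ℕ) : α.opp.Good p ↔ ¬ α.Good p := by
  cases α <;> simp [Player.opp, Player.Good]

theorem Player.exists_good (p : ℕ) : ∃ α : Player, α.Good p := by
  by_cases h : Even p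
  · exact ⟨.even, h⟩
  · exact ⟨.odd, h⟩

namespace ParityGame

variable {U : Type*}

theorem own_subset_verts (G : ParityGame U) (α : Player) : G.own α ⊆ G.verts := by
  rw [← G.own_union]
  cases α
  · exact Set.subset_union_left
  · exact Set.subset_union_right

theorem mem_own_or (G : ParityGame U) (α : Player) {v : U} (hv : v ∈ G.verts) :
    v ∈ G.own α ∨ v ∈ G.own α.opp := by
  rw [← G.own_union] at hv
  cases α
  · exact hv
  · exact hv.symm

theorem notMem_own_opp (G : ParityGame U) (α : Player) {v : U} (hv : v ∈ G.own α) :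
    v ∉ G.own α.opp := by
  have := Set.disjoint_left.1 G.own_disjoint
  intro h
  cases α
  · exact this hv h
  · exact this h hv

/-- The winning condition of player `α` for infinite plays. -/
def ParityCond (G : ParityGame U) (α : Player) (π : ℕ → U) : Prop :=
  ∃ p : ℕ, IsLeast {q : ℕ | ∃ᶠ i in Filter.atTop, G.prio (π i) = q} p ∧ α.Good p

theorem frequently_add_iff (P : ℕ → Prop) (k : ℕ) :
    (∃ᶠ i in Filter.atTop, P (i + k)) ↔ ∃ᶠ i in Filter.atTop, P i := by
  conv_rhs => rw [← Filter.map_add_atTop_eq_nat k]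
  exact Filter.frequently_map.symm

theorem ParityCond.of_tail {G : ParityGame U} {α : Player} {π : ℕ → U} (k : ℕ)
    (h : G.ParityCond α (fun i => π (i + k))) : G.ParityCond α π := by
  obtain ⟨p, hp, hg⟩ := h
  refine ⟨p, ?_, hg⟩
  have : {q : ℕ | ∃ᶠ i in Filter.atTop, G.prio (π i) = q} =
      {q : ℕ | ∃ᶠ i in Filter.atTop, G.prio (π (i + k)) = q} := by
    ext q
    exact (frequently_add_iff (fun i => G.prio (π i) = q) k).symm
  rwa [this]

theorem PlayWonBy.not_opp {G : ParityGame U} {α : Player} {N : ℕ∞} {π : ℕ → U}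
    (h : G.PlayWonBy α N π) : ¬ G.PlayWonBy α.opp N π := by
  rintro (⟨m, rfl, hm⟩ | ⟨rfl, q, hq, hgq⟩)
  · rcases h with ⟨n, hn, hown⟩ | ⟨hn, -⟩
    · obtain rfl : m = n := by exact_mod_cast hn
      exact G.notMem_own_opp _ hown hm
    · exact ENat.natCast_ne_top m hn
  · rcases h with ⟨n, hn, -⟩ | ⟨-, p, hp, hgp⟩
    · exact ENat.natCast_ne_top n hn.symm
    · rw [hp.unique hq] at hgp
      exact (α.good_opp q).1 hgq hgp

/-! ### Forcing with positional strategies -/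

/-- The infinite path `π` moves along edges and follows `f` at the vertices of `α`. -/
def Follows (G : ParityGame U) (α : Player) (f : U → U) (π : ℕ → U) : Prop :=
  ∀ i, G.edge (π i) (π (i + 1)) ∧ (π i ∈ G.own α → π (i + 1) = f (π i))

theorem Follows.tail {G : ParityGame U} {α : Player} {f : U → U} {π : ℕ → U}
    (h : G.Follows α f π) (k : ℕ) : G.Follows α f (fun i => π (i + k)) := by
  intro i
  have := h (i + k)
  rwa [Nat.add_right_comm] at this

theorem Follows.congr {G : ParityGame U} {α : Player} {f g : U → U} {π : ℕ → U}
    (h : G.Follows α f π) (hfg : ∀ i, f (π i) = g (π i)) : G.Follows α g π :=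
  fun i => ⟨(h i).1, fun ho => by rw [← hfg, (h i).2 ho]⟩

/-- At the vertices of `S`, player `α` following `f` does not leave `R`, as far as moves inside `X`
are concerned: her own vertices have an edge to their value under `f`, which lies in `R`, and the
opponent has no edge to `X \ R`. In particular `S` contains no sink of `α`. -/
def Keeps (G : ParityGame U) (α : Player) (X : Set U) (f : U → U) (S R : Set U) : Prop :=
  ∀ v ∈ S, (v ∈ G.own α → G.edge v (f v) ∧ f v ∈ R) ∧
    (v ∈ G.own α.opp → ∀ w ∈ X, G.edge v w → w ∈ R)

/-- In the subgame on `X`, player `α` has a positional strategy that, from every vertex of `D`,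
stays in `D` and does not get stuck until `T` is reached, and that ensures the condition `C` for the
infinite plays that never reach `T`. For `T = ∅` and the parity condition these are the positional
dominions; for `C` constantly false, `α` forces the play to reach `T` or a sink of the opponent. -/
def Forces (G : ParityGame U) (α : Player) (X T : Set U) (C : (ℕ → U) → Prop) (D : Set U) : Prop :=
  D ⊆ X ∧ ∃ f : U → U, G.Keeps α X f (D \ T) D ∧
    ∀ π : ℕ → U, (∀ i, π i ∈ D \ T) → G.Follows α f π → C π

theorem Keeps.step {G : ParityGame U} {α : Player} {X S R : Set U} {f g : U → U} {π : ℕ → U}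
    (hX : X ⊆ G.verts) (hRX : ∀ i, π i ∈ X) (h : G.Keeps α X f S R) (hπ : G.Follows α g π)
    {i : ℕ} (hi : π i ∈ S) (hfg : f (π i) = g (π i)) : π (i + 1) ∈ R := by
  rcases G.mem_own_or α (hX (hRX i)) with ho | ho
  · rw [(hπ i).2 ho, ← hfg]
    exact ((h _ hi).1 ho).2
  · exact (h _ hi).2 ho _ (hRX _) (hπ i).1

/-- Gluing of strategies: `D` can be enlarged by a set `E` from which `α` stays in `E ∪ D` and
achieves `C` if the play never enters `D` or `T`. -/
theorem Forces.union {G : ParityGame U} {α : Player} {X T : Set U} {C : (ℕ → U) → Prop} {D E : Set U}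
    (hX : X ⊆ G.verts) (hC : ∀ π k, C (fun i => π (i + k)) → C π)
    (hD : G.Forces α X T C D) (hE : E ⊆ X) (g : U → U)
    (hg : G.Keeps α X g (E \ (D ∪ T)) (E ∪ D))
    (hgC : ∀ π : ℕ → U, (∀ i, π i ∈ E \ (D ∪ T)) → G.Follows α g π → C π) :
    G.Forces α X T C (E ∪ D) := by
  classical
  obtain ⟨hDX, f, hf, hfC⟩ := hD
  refine ⟨Set.union_subset hE hDX, fun v => if v ∈ D then f v else g v, ?_, ?_⟩
  · rintro v ⟨hv, hvT⟩
    by_cases hvD : v ∈ D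
    · simp only [if_pos hvD]
      exact ⟨fun ho => (((hf v ⟨hvD, hvT⟩).1 ho).imp_right Or.inr),
        fun ho w hw he => Or.inr ((hf v ⟨hvD, hvT⟩).2 ho w hw he)⟩
    · simp only [if_neg hvD]
      exact hg v ⟨hv.resolve_right hvD, fun h => h.elim hvD hvT⟩
  · intro π hπ hfol
    have hπX : ∀ i, π i ∈ X := fun i => Set.union_subset hE hDX (hπ i).1
    by_cases hex : ∃ k, π k ∈ D
    · obtain ⟨k, hk⟩ := hex
      have hstay : ∀ i, π (i + k) ∈ D := by
        intro i
        induction i with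
        | zero => simpa using hk
        | succ i ih =>
          rw [Nat.add_right_comm]
          exact hf.step hX hπX hfol ⟨ih, (hπ _).2⟩ (if_pos ih).symm
      exact hC π k (hfC _ (fun i => ⟨hstay i, (hπ _).2⟩)
        ((hfol.tail k).congr fun i => if_pos (hstay i)))
    · push Not at hex
      exact hgC π (fun i => ⟨(hπ i).1.resolve_right (hex i), fun h => h.elim (hex i) (hπ i).2⟩)
        (hfol.congr fun i => if_neg (hex i))

/-- A maximal set from which `α` forces `C` is closed under control predecessors. -/
theorem Forces.notMem_of_maximal {G : ParityGame U} {α : Player} {X T : Set U}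
    {C : (ℕ → U) → Prop} {D : Set U}
    (hX : X ⊆ G.verts) (hC : ∀ π k, C (fun i => π (i + k)) → C π)
    (hD : G.Forces α X T C D) (hmax : ∀ D', D ⊆ D' → G.Forces α X T C D' → D' ⊆ D)
    {v : U} (hv : v ∈ X) (hvD : v ∉ D) :
    (v ∈ G.own α → ∀ u ∈ D, ¬ G.edge v u) ∧
    (v ∈ G.own α.opp → ∃ w ∈ X, G.edge v w ∧ w ∉ D) := by
  have key : ∀ u, (v ∈ G.own α → G.edge v u ∧ u ∈ D) →
      (v ∈ G.own α.opp → ∀ w ∈ X, G.edge v w → w ∈ D) → False := by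
    intro u h1 h2
    have hk : G.Keeps α X (fun _ => u) ({v} \ (D ∪ T)) D := by
      rintro x ⟨rfl, -⟩
      exact ⟨h1, h2⟩
    refine hvD (hmax _ Set.subset_union_right
      (hD.union hX hC (Set.singleton_subset_iff.2 hv) (fun _ => u) ?_ ?_) (Or.inl rfl))
    · exact fun x hx => ⟨fun ho => ((hk x hx).1 ho).imp_right Or.inr,
        fun ho w hw he => Or.inr ((hk x hx).2 ho w hw he)⟩
    · intro π hπ hfol
      have hπX : ∀ i, π i ∈ X := fun i => by rw [(hπ i).1]; exact hv
      exact absurd (Or.inl (hk.step hX hπX hfol (hπ 0) rfl)) (hπ 1).2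
  constructor
  · intro ho u hu he
    exact key u (fun _ => ⟨he, hu⟩) (fun ho' => absurd ho' (G.notMem_own_opp α ho))
  · intro ho
    by_contra! hcon
    exact key v (fun ho' => absurd ho (G.notMem_own_opp α ho')) (fun _ => hcon)

theorem Forces.exists_maximal {G : ParityGame U} {α : Player} {X T : Set U}
    {C : (ℕ → U) → Prop} (hX : X ⊆ G.verts) {D₀ : Set U} (h : G.Forces α X T C D₀) :
    ∃ D, D₀ ⊆ D ∧ G.Forces α X T C D ∧ ∀ D', D ⊆ D' → G.Forces α X T C D' → D' ⊆ D := by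
  have hfin : {D | G.Forces α X T C D}.Finite :=
    (G.finite_verts.subset hX).powerset.subset fun D hD => hD.1
  obtain ⟨D, hle, hD⟩ := hfin.exists_le_maximal h
  exact ⟨D, hle, hD.prop, fun D' hDD' hD' => hD.le_of_ge hD' hDD'⟩

/-! ### Positional determinacy -/

/-- One step of Zielonka's algorithm: in a nonempty subgame `Y` of `X` without sinks, between the
maximal dominions of the players, some player can extend her dominion. -/
theorem false_of_nonempty_rest {G : ParityGame U} {X : Set U} (hX : X ⊆ G.verts)
    (ih : ∀ Z, Z ⊂ X → ∃ D : Player → Set U,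
      (∀ β, G.Forces β Z ∅ (G.ParityCond β) (D β)) ∧ ∀ v ∈ Z, ∃ β, v ∈ D β)
    (D : Player → Set U) (hD : ∀ β, G.Forces β X ∅ (G.ParityCond β) (D β))
    (hmax : ∀ β D', D β ⊆ D' → G.Forces β X ∅ (G.ParityCond β) D' → D' ⊆ D β)
    {Y : Set U} (hY : Y = {v | v ∈ X ∧ ∀ β, v ∉ D β}) (hne : Y.Nonempty) : False := by
  classical
  have hYX : Y ⊆ X := by rw [hY]; exact fun v hv => hv.1
  have hYD : ∀ v ∈ Y, ∀ β, v ∉ D β := by rw [hY]; exact fun v hv => hv.2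
  have hYmem : ∀ v ∈ X, ∀ β, v ∉ D β → v ∉ D β.opp → v ∈ Y := by
    intro v hv β h1 h2
    rw [hY]
    refine ⟨hv, fun γ => ?_⟩
    rcases β.eq_or_eq_opp γ with rfl | rfl
    exacts [h1, h2]
  have hclosed : ∀ β, ∀ v ∈ Y, (v ∈ G.own β → ∀ u ∈ D β, ¬ G.edge v u) ∧
      (v ∈ G.own β.opp → ∃ w ∈ X, G.edge v w ∧ w ∉ D β) := fun β v hv =>
    (hD β).notMem_of_maximal hX (fun _ k => ParityCond.of_tail k) (hmax β) (hYX hv) (hYD v hv β)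
  have hsucc : ∀ v ∈ Y, ∃ w ∈ Y, G.edge v w := by
    intro v hv
    obtain ⟨β, hβ⟩ : ∃ β : Player, v ∈ G.own β.opp := by
      rcases G.mem_own_or .even (hX (hYX hv)) with h | h
      exacts [⟨.odd, h⟩, ⟨.even, h⟩]
    obtain ⟨w, hwX, he, hw⟩ := (hclosed β v hv).2 hβ
    exact ⟨w, hYmem w hwX β hw fun h => (hclosed β.opp v hv).1 hβ w h he, he⟩
  obtain ⟨s, hs, hsYmin⟩ : ∃ s ∈ Y, ∀ v ∈ Y, G.prio s ≤ G.prio v :=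
    Set.exists_min_image Y G.prio (G.finite_verts.subset (hYX.trans hX)) hne
  obtain ⟨α, hα⟩ := Player.exists_good (G.prio s)
  have hYV : Y ⊆ G.verts := hYX.trans hX
  obtain ⟨T, hT⟩ : ∃ T, T = {v | v ∈ Y ∧ G.prio v = G.prio s} := ⟨_, rfl⟩
  have hTY : T ⊆ Y := by rw [hT]; exact fun v hv => hv.1
  have hTforce : G.Forces α Y T (fun _ => False) T :=
    ⟨hTY, id, fun v hv => absurd hv.1 hv.2, fun π hπ _ => (hπ 0).2 (hπ 0).1⟩
  obtain ⟨A, hTA, hA, hAmax⟩ := hTforce.exists_maximal hYV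
  have hsA : s ∈ A := hTA (by rw [hT]; exact ⟨hs, rfl⟩)
  have hAclosed : ∀ v ∈ Y \ A, v ∈ G.own α → ∀ u ∈ A, ¬ G.edge v u := fun v hv =>
    (hA.notMem_of_maximal hYV (fun _ _ h => h) hAmax hv.1 hv.2).1
  obtain ⟨E, hE, hEcover⟩ := ih (Y \ A)
    ⟨Set.sdiff_subset.trans hYX, fun h => (h (hYX hs)).2 hsA⟩
  -- the opponent's dominion in `Y \ A` extends her dominion in `X`, so it is empty
  have hEopp : E α.opp = ∅ := by
    obtain ⟨hEY, g, hg, hgC⟩ := hE α.opp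
    have hsub := hmax α.opp (E α.opp ∪ D α.opp) Set.subset_union_right
      ((hD α.opp).union hX (fun _ k => ParityCond.of_tail k)
        ((hEY.trans Set.sdiff_subset).trans hYX) g ?_ ?_)
    · refine Set.eq_empty_of_forall_notMem fun v hv => ?_
      exact hYD v (hEY hv).1 _ (hsub (Or.inl hv))
    · rintro v ⟨hv, -⟩
      refine ⟨fun ho => ((hg v ⟨hv, id⟩).1 ho).imp_right Or.inl, fun ho w hw he => ?_⟩
      by_cases hwD : w ∈ D α.opp
      · exact Or.inr hwD
      · rw [Player.opp_opp] at ho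
        have hwα : w ∉ D α := fun h => (hclosed α v (hEY hv).1).1 ho w h he
        have hwA : w ∉ A := fun h => hAclosed v (hEY hv) ho w h he
        exact Or.inl ((hg v ⟨hv, id⟩).2 (by rwa [Player.opp_opp]) w
          ⟨hYmem w hw α hwα hwD, hwA⟩ he)
    · exact fun π hπ => hgC π fun i => ⟨(hπ i).1, id⟩
  have hEα : ∀ v ∈ Y, v ∉ A → v ∈ E α := by
    intro v hv hvA
    obtain ⟨β, hβ⟩ := hEcover v ⟨hv, hvA⟩
    rcases α.eq_or_eq_opp β with rfl | rfl
    · exact hβ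
    · rw [hEopp] at hβ
      exact hβ.elim
  obtain ⟨hEY, g, hg, hgC⟩ := hE α
  obtain ⟨hAY, a, ha, haC⟩ := hA
  choose! n hnY hn using hsucc
  -- `α` wins all of `Y`: play `g` outside `A`, force a visit to `T` inside `A`, and stay in `Y` on `T`
  have hsub := hmax α (Y ∪ D α) Set.subset_union_right
    ((hD α).union hX (fun _ k => ParityCond.of_tail k) hYX
      (fun v => if v ∈ T then n v else if v ∈ A then a v else g v) ?_ ?_)
  · exact hYD s hs α (hsub (Or.inl hs))
  · rintro v ⟨hv, -⟩
    refine ⟨fun ho => ?_, fun ho w hw he => ?_⟩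
    · by_cases hvT : v ∈ T
      · simp only [if_pos hvT]
        exact ⟨hn v hv, Or.inl (hnY v hv)⟩
      by_cases hvA : v ∈ A
      · simp only [if_neg hvT, if_pos hvA]
        exact ((ha v ⟨hvA, hvT⟩).1 ho).imp_right fun h => Or.inl (hAY h)
      · simp only [if_neg hvT, if_neg hvA]
        exact ((hg v ⟨hEα v hv hvA, id⟩).1 ho).imp_right fun h => Or.inl (hEY h).1
    · by_cases hwD : w ∈ D α
      · exact Or.inr hwD
      · exact Or.inl (hYmem w hw α hwD fun h => (hclosed α.opp v hv).1 ho w h he)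
  · intro π hπ hfol
    have hπY : ∀ i, π i ∈ Y := fun i => (hπ i).1
    by_cases hfreq : ∃ᶠ i in Filter.atTop, π i ∈ T
    · refine ⟨G.prio s, ⟨hfreq.mono fun i hi => ?_, fun q hq => ?_⟩, hα⟩
      · rw [hT] at hi
        exact hi.2
      · obtain ⟨i, rfl⟩ := Filter.Frequently.exists hq
        exact hsYmin _ (hπY i)
    · obtain ⟨k, hk⟩ := Filter.eventually_atTop.1 (Filter.not_frequently.1 hfreq)
      by_cases hex : ∃ m ≥ k, π m ∈ A
      · obtain ⟨m, hm, hmA⟩ := hex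
        have hnT : ∀ i, π (i + m) ∉ T := fun i => hk _ (by lia)
        have hval : ∀ i, π (i + m) ∈ A →
            a (π (i + m)) = if π (i + m) ∈ T then n (π (i + m)) else
              if π (i + m) ∈ A then a (π (i + m)) else g (π (i + m)) := by
          intro i hi
          rw [if_neg (hnT i), if_pos hi]
        have hstay : ∀ i, π (i + m) ∈ A := by
          intro i
          induction i with
          | zero => simpa using hmA
          | succ i ih' =>
            rw [Nat.add_right_comm]
            exact ha.step hYV hπY hfol ⟨ih', hnT i⟩ (hval i ih')
        exact (haC _ (fun i => ⟨hstay i, hnT i⟩)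
          ((hfol.tail m).congr fun i => (hval i (hstay i)).symm)).elim
      · push Not at hex
        have hnA : ∀ i, π (i + k) ∉ A := fun i => hex _ (by lia)
        refine ParityCond.of_tail k (hgC _ (fun i => ⟨hEα _ (hπY _) (hnA i), id⟩)
          ((hfol.tail k).congr fun i => ?_))
        simp only [if_neg (hnA i), if_neg fun h => hnA i (hTA h)]

/-- Positional determinacy: every subgame is covered by positional dominions of the players. -/
theorem exists_forces_cover (G : ParityGame U) (X : Set U) (hX : X ⊆ G.verts) :
    ∃ D : Player → Set U,
      (∀ β, G.Forces β X ∅ (G.ParityCond β) (D β)) ∧ ∀ v ∈ X, ∃ β, v ∈ D β := by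
  obtain ⟨n, hn⟩ : ∃ n, X.ncard = n := ⟨_, rfl⟩
  induction n using Nat.strong_induction_on generalizing X with
  | _ n ih =>
    have hempty : ∀ β, G.Forces β X ∅ (G.ParityCond β) ∅ := fun β =>
      ⟨Set.empty_subset X, id, fun v hv => hv.1.elim, fun π hπ => (hπ 0).1.elim⟩
    choose D _ hD hmax using fun β => (hempty β).exists_maximal hX
    refine ⟨D, hD, fun v hv => ?_⟩
    by_contra! hcon
    refine false_of_nonempty_rest hX (fun Z hZ => ?_) D hD hmax rfl ⟨v, hv, hcon⟩
    exact ih _ (hn ▸ Set.ncard_lt_ncard hZ (G.finite_verts.subset hX)) Z (hZ.subset.trans hX) rfl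

theorem Forces.isDominion {G : ParityGame U} {β : Player} {D : Set U}
    (h : G.Forces β G.verts ∅ (G.ParityCond β) D) : G.IsDominion β D := by
  classical
  obtain ⟨hDV, f, hf, hfC⟩ := h
  let σ : G.Strategy β :=
    { move := fun _ v => if v ∈ D ∧ v ∈ G.own β then some (f v) else none
      legal := by
        intro _ v w hw
        split_ifs at hw with hv
        obtain rfl := Option.some.inj hw
        exact ⟨hv.2, ((hf v ⟨hv.1, id⟩).1 hv.2).1⟩ }
  have hmove : ∀ {N π}, σ.Consistent N π → ∀ i : ℕ, (i : ℕ∞) < N → π i ∈ D → π i ∈ G.own β →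
      π (i + 1) = f (π i) := fun hc i hi hiD ho => hc i hi _ (if_pos ⟨hiD, ho⟩)
  have hclosed : σ.ClosedOn D := by
    intro N π hπ h0 hc i
    induction i with
    | zero => exact fun _ => h0
    | succ i ih =>
      intro hi
      have hiN : (i : ℕ∞) < N := lt_of_lt_of_le (by exact_mod_cast Nat.lt_succ_self i) hi
      have hiD := ih hiN.le
      rcases G.mem_own_or β (hDV hiD) with ho | ho
      · rw [hmove hc i hiN hiD ho]
        exact ((hf _ ⟨hiD, id⟩).1 ho).2
      · have he := hπ.step i hiN
        exact (hf _ ⟨hiD, id⟩).2 ho _ (G.edge_mem _ _ he).2 he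
  refine ⟨hDV, σ, hclosed, ?_⟩
  rintro v hv N π hπ rfl hc
  have hstay := hclosed N π hπ hv hc
  by_cases hN : N = ⊤
  · subst hN
    refine Or.inr ⟨rfl, hfC π (fun i => ⟨hstay i le_top, id⟩) fun i => ?_⟩
    exact ⟨hπ.step i (ENat.natCast_lt_top i), hmove hc i (ENat.natCast_lt_top i) (hstay i le_top)⟩
  · obtain ⟨n, rfl⟩ := ENat.ne_top_iff_exists.1 hN
    refine Or.inl ⟨n, rfl, ?_⟩
    have hnD := hstay n le_rfl
    refine (G.mem_own_or β (hDV hnD)).resolve_left fun ho => ?_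
    exact (hπ.maximal n rfl).2 _ ((hf _ ⟨hnD, id⟩).1 ho).1

theorem IsDominion.wins {G : ParityGame U} {β : Player} {D : Set U} (h : G.IsDominion β D)
    {v : U} (hv : v ∈ D) : G.Wins β v :=
  ⟨h.1 hv, h.2.choose, h.2.choose_spec.2 v hv⟩

/-! ### No vertex is won by both players -/

theorem exists_consistent_play {G : ParityGame U} {α : Player} (σ : G.Strategy α)
    (τ : G.Strategy α.opp) {v : U} (hv : v ∈ G.verts) :
    ∃ N π, G.IsPlay N π ∧ π 0 = v ∧ σ.Consistent N π ∧ τ.Consistent N π := by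
  classical
  have hnext : ∀ (h : List U) (x : U), ∃ u, (x ∈ G.verts → x ∉ G.sinks → G.edge x u) ∧
      (∀ w, σ.move h x = some w → u = w) ∧ (∀ w, τ.move h x = some w → u = w) := by
    intro h x
    rcases hσ : σ.move h x with _ | w
    · rcases hτ : τ.move h x with _ | w
      · by_cases hx : ∃ u, G.edge x u
        · exact ⟨hx.choose, fun _ _ => hx.choose_spec, by simp, by simp⟩
        · exact ⟨x, fun h1 h2 => (h2 ⟨h1, not_exists.1 hx⟩).elim, by simp, by simp⟩
      · exact ⟨w, fun _ _ => (τ.legal _ _ _ hτ).2, by simp, by simp⟩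
    · refine ⟨w, fun _ _ => (σ.legal _ _ _ hσ).2, by simp, fun w' hτ => ?_⟩
      exact (G.notMem_own_opp α (σ.legal _ _ _ hσ).1 (τ.legal _ _ _ hτ).1).elim
  choose next hedge hσ hτ using hnext
  let s : ℕ → List U × U := fun n =>
    Nat.rec ([], v) (fun _ p => (p.1 ++ [p.2], next p.1 p.2)) n
  let π : ℕ → U := fun n => (s n).2
  have hhist : ∀ n, (s n).1 = (List.range n).map π := by
    intro n
    induction n with
    | zero => rfl
    | succ n ih =>
      rw [List.range_succ, List.map_append, ← ih]
      rfl
  have hstep : ∀ n, π (n + 1) = next ((List.range n).map π) (π n) := by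
    intro n
    rw [← hhist]
  have hcσ : ∀ N, σ.Consistent N π := fun N i _ w hw => by rw [hstep]; exact hσ _ _ w hw
  have hcτ : ∀ N, τ.Consistent N π := fun N i _ w hw => by rw [hstep]; exact hτ _ _ w hw
  have hmem : ∀ n, (∀ i < n, π i ∉ G.sinks) → π n ∈ G.verts := by
    intro n
    induction n with
    | zero => exact fun _ => hv
    | succ n ih =>
      intro h
      rw [hstep]
      exact (G.edge_mem _ _ (hedge _ _ (ih fun i hi => h i (by lia)) (h n (by lia)))).2
  have hpath : ∀ n, (∀ i ≤ n, π i ∉ G.sinks) → G.edge (π n) (π (n + 1)) := by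
    intro n h
    rw [hstep]
    exact hedge _ _ (hmem n fun i hi => h i hi.le) (h n le_rfl)
  by_cases hex : ∃ n, π n ∈ G.sinks
  · refine ⟨(Nat.find hex : ℕ), π, ⟨hv, fun i hi => ?_, fun n hn => ?_⟩, rfl, hcσ _, hcτ _⟩
    · have hi' : i < Nat.find hex := by exact_mod_cast hi
      exact hpath i fun j hj => Nat.find_min hex (lt_of_le_of_lt hj hi')
    · obtain rfl : Nat.find hex = n := by exact_mod_cast hn
      exact Nat.find_spec hex
  · refine ⟨⊤, π, ⟨hv, fun i _ => ?_, fun n hn => ?_⟩, rfl, hcσ _, hcτ _⟩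
    · exact hpath i fun j _ hj => hex ⟨j, hj⟩
    · exact (ENat.natCast_ne_top n hn.symm).elim

theorem not_wins_both {G : ParityGame U} {α : Player} {v : U} (h₁ : G.Wins α v) :
    ¬ G.Wins α.opp v := by
  rintro ⟨hv, τ, hτ⟩
  obtain ⟨-, σ, hσ⟩ := h₁
  obtain ⟨N, π, hπ, h0, hcσ, hcτ⟩ := exists_consistent_play σ τ hv
  exact (hσ N π hπ h0 hcσ).not_opp (hτ N π hπ h0 hcτ)

theorem union_cpre_attr_subset (G : ParityGame U) (α : Player) (X : Set U) :
    X ∪ G.cpre α (G.attr α X) ⊆ G.attr α X :=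
  (OrderHom.map_lfp
    { toFun := fun Z => X ∪ G.cpre α Z
      monotone' := fun _ _ h => Set.union_subset_union_right X (G.cpre_mono α h) }).le

theorem attr_subset {G : ParityGame U} {α : Player} {X Z : Set U}
    (h : X ∪ G.cpre α Z ⊆ Z) : G.attr α X ⊆ Z :=
  OrderHom.lfp_le _ h

end ParityGame

/-! ### Extensions of incomplete games -/

namespace IncompleteParityGame

variable {U : Type*}

/-- The opponent of `β` cannot leave the `β`-safe vertices, not even in an extension. -/
theorem edge_restrict_safe_of_opp {𝒢 𝒢' : IncompleteParityGame U} (hext : 𝒢.IsExtendedBy 𝒢')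
    {β : Player} {v w : U} (hv : v ∈ 𝒢.safe β) (ho : v ∈ 𝒢.game.own β.opp)
    (he : 𝒢'.game.edge v w) : (𝒢.game.restrict (𝒢.safe β)).edge v w := by
  have hfix := 𝒢.game.union_cpre_attr_subset β.opp (𝒢.game.own β.opp ∩ 𝒢.incomplete)
  have hvI : v ∉ 𝒢.incomplete := fun h => hv.2 (hfix (Or.inl ⟨ho, h⟩))
  have heG : 𝒢.game.edge v w := hext.edge_complete v ⟨hv.1, hvI⟩ w he
  refine ⟨heG, hv, (𝒢.game.edge_mem _ _ heG).2, fun hw => ?_⟩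
  exact hv.2 (hfix (Or.inr (Or.inl ⟨ho, hv.1, w, hw, heG⟩)))

/-- A vertex of `W β` is won by `β` in every extension. -/
theorem wins_of_mem_W {𝒢 𝒢' : IncompleteParityGame U} (hext : 𝒢.IsExtendedBy 𝒢')
    {β : Player} {v : U} (hv : v ∈ 𝒢.W β) : 𝒢'.game.Wins β v := by
  classical
  obtain ⟨D, hD, hvD⟩ := hv
  set H := 𝒢.game.restrict (𝒢.safe β)
  obtain ⟨hvH, σ, hσ⟩ : H.Wins β v := ParityGame.IsDominion.wins hD hvD
  -- where `σ` leaves the choice open, `β` has to pick an edge of the safe subgame,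
  -- since an extension may offer further moves
  let σ' : 𝒢'.game.Strategy β :=
    { move := fun h x => (σ.move h x).orElse fun _ =>
        if hx : x ∈ H.own β ∧ ∃ w, H.edge x w then some hx.2.choose else none
      legal := by
        intro h x w hw
        rcases hs : σ.move h x with _ | w'
        · rw [hs] at hw
          simp only [Option.orElse_none] at hw
          split_ifs at hw with hx
          obtain rfl := Option.some.inj hw
          exact ⟨hext.own_subset β hx.1.1, hext.edge_mono _ _ hx.2.choose_spec.1⟩
        · rw [hs] at hw
          simp only [Option.orElse_some, Option.some.injEq] at hw
          subst hw
          have := σ.legal _ _ _ hs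
          exact ⟨hext.own_subset β this.1.1, hext.edge_mono _ _ this.2.1⟩ }
  refine ⟨hext.verts_subset hvH.1, σ', ?_⟩
  rintro N π hπ rfl hc
  have hcσ : ∀ M ≤ N, σ.Consistent M π := by
    intro M hM i hi w hw
    refine hc i (hi.trans_le hM) w ?_
    simp only [σ', hw, Option.orElse_some]
  have hpath : ∀ i : ℕ, (i : ℕ∞) < N → H.edge (π i) (π (i + 1)) := by
    intro i
    induction i using Nat.strong_induction_on with
    | _ i ih =>
      intro hi
      have hbelow : ∀ j < i, H.edge (π j) (π (j + 1)) := fun j hj =>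
        ih j hj (lt_trans (by exact_mod_cast hj) hi)
      have hiH : π i ∈ H.verts := by
        rcases i with _ | i
        · exact hvH
        · exact (H.edge_mem _ _ (hbelow i (Nat.lt_succ_self i))).2
      rcases H.mem_own_or β hiH with ho | ho
      · rcases hs : σ.move ((List.range i).map π) (π i) with _ | w
        · by_cases hx : ∃ w, H.edge (π i) w
          · have hw := hc i hi hx.choose (by
              simp only [σ', hs, Option.orElse_none, dif_pos (And.intro ho hx)])
            rw [hw]
            exact hx.choose_spec
          · -- a sink of `β` in the subgame would end a lost play that is consistent with `σ`
            have hplay : H.IsPlay (i : ℕ∞) π :=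
              ⟨hvH, fun j hj => hbelow j (by exact_mod_cast hj), fun n hn => by
                obtain rfl : i = n := by exact_mod_cast hn
                exact ⟨hiH, not_exists.1 hx⟩⟩
            rcases hσ _ π hplay rfl (hcσ _ hi.le) with ⟨n, hn, hown⟩ | ⟨hn, -⟩
            · obtain rfl : i = n := by exact_mod_cast hn
              exact (H.notMem_own_opp β ho hown).elim
            · exact (ENat.natCast_ne_top i hn).elim
        · rw [hcσ N le_rfl i hi w hs]
          exact (σ.legal _ _ _ hs).2
      · exact edge_restrict_safe_of_opp hext ho.2 ho.1 (hπ.step i hi)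
  have hmem : ∀ i : ℕ, (i : ℕ∞) ≤ N → π i ∈ H.verts := by
    rintro (_ | i) hi
    · exact hvH
    · exact (H.edge_mem _ _ (hpath i
        (lt_of_lt_of_le (by exact_mod_cast Nat.lt_succ_self i) hi))).2
  have hplay : H.IsPlay N π := by
    refine ⟨hvH, hpath, fun n hn => ⟨hmem n hn.ge, fun w he => ?_⟩⟩
    exact (hπ.maximal n hn).2 w (hext.edge_mono _ _ he.1)
  rcases hσ N π hplay rfl (hcσ N le_rfl) with ⟨n, hn, hown⟩ | ⟨rfl, p, hp, hg⟩
  · exact Or.inl ⟨n, hn, hext.own_subset _ hown.1⟩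
  · refine Or.inr ⟨rfl, p, ?_, hg⟩
    have hprio : ∀ i, 𝒢'.game.prio (π i) = H.prio (π i) := fun i =>
      (hext.prio_eq _ (hmem i le_top).1).symm
    simpa only [hprio] using hp

/-- The extension that favours `α` most: there is a new sink `t` of the opponent, the incomplete
vertices of `α` get an edge to `t`, and all vertices become complete. -/
def favour (𝒢 : IncompleteParityGame U) (α : Player) (t : U) (ht : t ∉ 𝒢.game.verts) :
    IncompleteParityGame U where
  game :=
    { verts := insert t 𝒢.game.verts
      finite_verts := 𝒢.game.finite_verts.insert t
      own := fun β => 𝒢.game.own β ∪ {v | v = t ∧ β = α.opp}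
      own_union := by
        rw [← 𝒢.game.own_union]
        ext v
        cases α
        · simp [Player.opp]
        · simp [Player.opp]
          tauto
      own_disjoint := by
        rw [Set.disjoint_left]
        rintro v (h₁ | ⟨rfl, h₁⟩) (h₂ | ⟨h, h₂⟩)
        · exact Set.disjoint_left.1 𝒢.game.own_disjoint h₁ h₂
        · exact ht (h ▸ 𝒢.game.own_subset_verts _ h₁)
        · exact ht (𝒢.game.own_subset_verts _ h₂)
        · exact Player.noConfusion (h₁.trans h₂.symm)
      edge := fun v w => 𝒢.game.edge v w ∨ (v ∈ 𝒢.game.own α ∩ 𝒢.incomplete ∧ w = t)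
      edge_mem := by
        rintro v w (h | ⟨h, rfl⟩)
        · exact ⟨Or.inr (𝒢.game.edge_mem _ _ h).1, Or.inr (𝒢.game.edge_mem _ _ h).2⟩
        · exact ⟨Or.inr (𝒢.incomplete_subset h.2), Or.inl rfl⟩
      prio := 𝒢.game.prio }
  incomplete := ∅
  incomplete_subset := Set.empty_subset _

theorem isExtendedBy_favour (𝒢 : IncompleteParityGame U) (α : Player) (t : U)
    (ht : t ∉ 𝒢.game.verts) : 𝒢.IsExtendedBy (𝒢.favour α t ht) where
  verts_subset := Set.subset_insert _ _
  own_subset _ := Set.subset_union_left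
  edge_mono _ _ := Or.inl
  edge_complete _ hv _ h := h.resolve_right fun h' => hv.2 h'.1.2
  prio_eq _ _ := rfl
  incomplete_subset := fun _ h => h.1.elim

/-- A positional dominion of the opponent in the game that favours `α` is one in her safe subgame
of the original game. -/
theorem isDominion_restrict_safe {𝒢 : IncompleteParityGame U} {α : Player} {t : U}
    {ht : t ∉ 𝒢.game.verts} {D : Set U}
    (hD : (𝒢.favour α t ht).game.Forces α.opp (𝒢.favour α t ht).game.verts ∅
      ((𝒢.favour α t ht).game.ParityCond α.opp) D) :
    (𝒢.game.restrict (𝒢.safe α.opp)).IsDominion α.opp D := by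
  obtain ⟨hDV, f, hf, hfC⟩ := hD
  have hedge {v w : U} (h : 𝒢.game.edge v w) : (𝒢.favour α t ht).game.edge v w := Or.inl h
  have hout : ∀ v, ¬ 𝒢.game.edge t v := fun v h => ht (𝒢.game.edge_mem _ _ h).1
  have htD : t ∉ D := by
    intro h
    rcases ((hf t ⟨h, id⟩).1 (Or.inr ⟨rfl, rfl⟩)).1 with he | ⟨hI, -⟩
    · exact hout _ he
    · exact ht (𝒢.incomplete_subset hI.2)
  have hDG : D ⊆ 𝒢.game.verts := fun v hv =>
    (hDV hv).resolve_left fun h => htD (h ▸ hv)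
  have hα : ∀ v ∈ D, v ∈ 𝒢.game.own α → ∀ w, (𝒢.favour α t ht).game.edge v w → w ∈ D :=
    fun v hv ho w he => (hf v ⟨hv, id⟩).2 (Or.inl (by rwa [Player.opp_opp])) w
      (ParityGame.edge_mem _ _ _ he).2 he
  have hopp : ∀ v ∈ D, v ∈ 𝒢.game.own α.opp → 𝒢.game.edge v (f v) ∧ f v ∈ D := by
    intro v hv ho
    obtain ⟨he, hfD⟩ := (hf v ⟨hv, id⟩).1 (Or.inl ho)
    exact ⟨he.resolve_right fun h => htD (h.2 ▸ hfD), hfD⟩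
  have hattr : 𝒢.game.attr α (𝒢.game.own α ∩ 𝒢.incomplete) ⊆ Dᶜ := by
    apply ParityGame.attr_subset
    rintro v (hI | ⟨ho, -, u, hu, he⟩ | ⟨ho, hpre⟩) hv
    · exact htD (hα v hv hI.1 t (Or.inr ⟨hI, rfl⟩))
    · exact hu (hα v hv ho u (hedge he))
    · obtain ⟨he, hfD⟩ := hopp v hv ho
      exact hpre (Or.inl ⟨hDG hv, f v, ⟨hDG hfD, fun h => h hfD⟩, he⟩)
  have hDs : D ⊆ 𝒢.safe α.opp := by
    intro v hv
    refine ⟨hDG hv, ?_⟩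
    rw [Player.opp_opp]
    exact fun h => hattr h hv
  refine ParityGame.Forces.isDominion ⟨fun v hv => ⟨hDG hv, hDs hv⟩, f, ?_, ?_⟩
  · rintro v ⟨hv, -⟩
    refine ⟨fun ho => ?_, fun ho w _ he => ?_⟩
    · obtain ⟨he, hfD⟩ := hopp v hv ho.1
      exact ⟨⟨he, hDs hv, hDs hfD⟩, hfD⟩
    · rw [Player.opp_opp] at ho
      exact hα v hv ho.1 w (hedge he.1)
  · intro π hπ hfol
    refine hfC π hπ fun i => ⟨hedge (hfol i).1.1, ?_⟩
    rintro (ho | ⟨h, -⟩)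
    · exact (hfol i).2 ⟨ho, hDs (hπ i).1⟩
    · exact (htD (h ▸ (hπ i).1)).elim

/-- By determinacy, `α` can win all vertices outside `W` of her opponent. -/
theorem wins_favour_or_mem_W (𝒢 : IncompleteParityGame U) (α : Player) (t : U)
    (ht : t ∉ 𝒢.game.verts) {v : U} (hv : v ∈ 𝒢.game.verts) :
    (𝒢.favour α t ht).game.Wins α v ∨ v ∈ 𝒢.W α.opp := by
  obtain ⟨D, hD, hcover⟩ := (𝒢.favour α t ht).game.exists_forces_cover _ subset_rfl
  obtain ⟨β, hβ⟩ := hcover v (Or.inr hv)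
  rcases α.eq_or_eq_opp β with rfl | rfl
  · exact Or.inl ((hD β).isDominion.wins hβ)
  · exact Or.inr ⟨D α.opp, isDominion_restrict_safe (hD α.opp), hβ⟩

theorem mem_Wunknown {𝒢 : IncompleteParityGame U} (α : Player) {v : U} :
    v ∈ 𝒢.Wunknown ↔ v ∈ 𝒢.game.verts ∧ v ∉ 𝒢.W α ∧ v ∉ 𝒢.W α.opp := by
  cases α
  · simp [Wunknown, Player.opp]
  · simp [Wunknown, Player.opp, and_comm]

end IncompleteParityGame

theorem theorem1 {U : Type*} [Infinite U] (𝒢 : IncompleteParityGame U) (α : Player) :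
    IsGreatest
      {X : Set U | X ⊆ 𝒢.game.verts ∧ ∀ v ∈ X, ∃ 𝒢₁ 𝒢₂ : IncompleteParityGame U,
        𝒢.IsExtendedBy 𝒢₁ ∧ 𝒢.IsExtendedBy 𝒢₂ ∧
        𝒢₁.game.Wins α v ∧ 𝒢₂.game.Wins α.opp v}
      𝒢.Wunknown := by
  refine ⟨⟨Set.sdiff_subset, fun v hv => ?_⟩, ?_⟩
  · obtain ⟨t, ht⟩ := 𝒢.game.finite_verts.exists_notMem
    obtain ⟨hvG, hvα, hvopp⟩ := (IncompleteParityGame.mem_Wunknown α).1 hv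
    refine ⟨𝒢.favour α t ht, 𝒢.favour α.opp t ht, 𝒢.isExtendedBy_favour _ _ _,
      𝒢.isExtendedBy_favour _ _ _, ?_, ?_⟩
    · exact (𝒢.wins_favour_or_mem_W α t ht hvG).resolve_right hvopp
    · exact (𝒢.wins_favour_or_mem_W α.opp t ht hvG).resolve_right (by rwa [Player.opp_opp])
  · rintro X ⟨hXG, hX⟩ v hv
    obtain ⟨𝒢₁, 𝒢₂, h₁, h₂, hw₁, hw₂⟩ := hX v hv
    refine (IncompleteParityGame.mem_Wunknown α).2 ⟨hXG hv, fun h => ?_, fun h => ?_⟩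
    · exact ParityGame.not_wins_both (IncompleteParityGame.wins_of_mem_W h₂ h) hw₂
    · exact ParityGame.not_wins_both hw₁ (IncompleteParityGame.wins_of_mem_W h₁ h)
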